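/- Let $N\ge 3$ be odd, $S_N=[1,N]$, where $[a,b]=\{h\in\mathbb Z: a\le h\le b\}$ (empty if $a>b$), and $F=\mathbb Z/2\mathbb Z$. View the set of subsets of $S_N$ as an $F$-vector space, addition being symmetric difference. **Pairings.** Let $B$ be a set of pairwise disjoint two-element subsets of $S_N$. Write $\mathrm{supp}(B)$ for their union, $B^0$ (resp. $B^1$) for the set of $\{i,j\}\in B$ with $i-j$ even (resp. odd), $s=|B^0|$, and $\langle B\rangle$ for the $F$-span of the elements of $B$. A set is *0-covered* if it is a (possibly empty) disjoint union of intervals $[a,b]$ with $\{a,b\}\in B^1$, $a<b$; it is *1-covered* if it is the disjoint union of a 0-covered set and a one-element set. Let ${}^*\mathcal P_N$ be the set of all such $B$ for which - $[i+1,j-1]$ is 0-covered for all $\{i,j\}\in B^1$ with $i<j$; - there are $i_1<i_2<\dots<i_{2s}$ in $S_N$ with $B^0=\{\{i_1,i_{2s}\},\{i_2,i_{2s-1}\},\dots,\{i_s,i_{s+1}\}\}$, and $[i_k+1,i_{k+1}-1]$ is 0-covered for all $1\le k\le 2s-1$ with $k\ne s$. **The sets $\mathcal X$.** Let $\mathcal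 X^+$ be the set of $B\in{}^*\mathcal P_N$ such that $N\notin\mathrm{supp}(B)$ and either $s=0$, or $s$ is odd and one of the following holds: (i) $[1,i_1-1]$ is 1-covered and $[i_{2s}+1,N-1]$ is 0-covered; (ii) $[1,i_1-1]$ is 0-covered and $[i_{2s}+1,N-1]$ is 1-covered. For $B\in\mathcal X^+$ with $s$ odd let $u_B$ be the unique $u$ such that, in case (i), $u\in[1,i_1-1]$ and $[1,u-1]$, $[u+1,i_1-1]$ are 0-covered, and, in case (ii), $u\in[i_{2s}+1,N-1]$ and $[i_{2s}+1,u-1]$, $[u+1,N-1]$ are 0-covered. Let $\mathcal X^-$ be the set of $B\in{}^*\mathcal P_N$ such that either $s=0$ or both $[1,i_1-1]$ and $[i_{2s}+1,N]$ are 0-covered, and such that $\{i,N\}\in B$ for some $i\equiv s \pmod 2$. Put $\mathcal X=\mathcal X^+\sqcup\mathcal X^-$. **Grading.** For $t\in2\mathbb Z$ let $\mathcal X^{t,+}$ be the set of $B\in\mathcal X^+$ with $|B^0|=0$ if $t=0$; with $|B^0|=t-1$ and $u_B$ odd if $t>0$; with $|B^0|=-t-1$ and $u_B$ even if $t<0$.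 Let $\mathcal X^{t,-}$ be the set of $B\in\mathcal X^-$ with $|B^0|=0$ if $t=0$; with $|B^0|=t$ and $\{i,N\}\in B$ for some even $i$ if $t>0$; with $|B^0|=-t-1$ and $\{i,N\}\in B$ for some odd $i$ if $t<0$. Let ${}'\mathcal X^{0,+}=\{B\in\mathcal X^{0,+}: N-1\notin\mathrm{supp}(B)\}$. **The relation $\preceq$.** For $i<j$ in $S_N$ put $[[\{i,j\}]]=[i,j]$ if $j-i$ is odd and $[[\{i,j\}]]=[j,N]\cup[1,i]$ if $j-i$ is even. For $B\in\mathcal X$ let ${}'\epsilon(B)=\sum_{X\in B}[[X]]+\delta_B$, where $\delta_B=[u_B,N]$ if $B\in\mathcal X^+$, $|B^0|$ is odd and $u_B$ is even; $\delta_B=\{N\}+[1,u_B]$ if $B\in\mathcal X^+$, $|B^0|$ is odd and $u_B$ is odd; and $\delta_B=0$ otherwise. For $B',B\in\mathcal X$ write $B'\preceq B$ if there is a sequence $B'=B_0,B_1,\dots,B_h=B$ in $\mathcal X$ ($h\ge0$) with ${}'\epsilon(B_k)\in\langle B_{k+1}\rangle$ for $0\le k<h$. **Theorem.** Let $t,t'\in2\mathbb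 Z$. 1. If $B'\in\mathcal X^{t',+}$, $B\in\mathcal X^{t,+}$, $B'\preceq B$ and $t<0$, then $t'=t$ or $|t'|<|t|$. 2. If $B'\in\mathcal X$, $B\in{}'\mathcal X^{0,+}$ and $B'\preceq B$, then $B'\in{}'\mathcal X^{0,+}$. 3. If $B'\in\mathcal X^{t',-}$, $B\in\mathcal X^{t,-}$, $B'\preceq B$ and $t\ge0$, then $t'=t$ or $|t'+1|<|t+1|$. -/

import Mathlib

open scoped symmDiff

namespace PairSets

/-- A finite set of unordered pairs of natural numbers. -/
abbrev Pairs := Finset (Sym2 ℕ)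

/-- `𝒫_N`: sets of pairwise disjoint two-element subsets of `S_N = [1, N]`. -/
def P (N : ℕ) : Set Pairs :=
  {B | (∀ X ∈ B, ¬ X.IsDiag ∧ X.toFinset ⊆ Finset.Icc 1 N) ∧
    ∀ X ∈ B, ∀ Y ∈ B, X ≠ Y → Disjoint X.toFinset Y.toFinset}

/-- The union of the pairs in `B`. -/
def supp (B : Pairs) : Finset ℕ := B.biUnion Sym2.toFinset

/-- `B⁰`: the pairs `{i, j}` in `B` with `i - j` even. -/
def even (B : Pairs) : Pairs := B.filter fun X => Even (X.sup - X.inf)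

/-- `B¹`: the pairs `{i, j}` in `B` with `i - j` odd. -/
def odd (B : Pairs) : Pairs := B.filter fun X => Odd (X.sup - X.inf)

/-- The interval `[i, j]` attached to a pair `{i, j}` with `i ≤ j`. -/
def seg (X : Sym2 ℕ) : Finset ℕ := Finset.Icc X.inf X.sup

/-- `X` is `0`-covered by `C`: it is a disjoint union of intervals `[a, b]` with `{a, b} ∈ C`,
`a < b` (the empty union is allowed). -/
def Covered0 (C : Pairs) (X : Finset ℕ) : Prop :=
  ∃ T ⊆ C, (∀ p ∈ T, ∀ q ∈ T, p ≠ q → Disjoint (seg p) (seg q)) ∧ X = T.biUnion seg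

/-- `X` is `1`-covered by `C`: it is a disjoint union of intervals `[a, b]` with `{a, b} ∈ C`,
`a < b`, and of one singleton. -/
def Covered1 (C : Pairs) (X : Finset ℕ) : Prop :=
  ∃ T ⊆ C, (∀ p ∈ T, ∀ q ∈ T, p ≠ q → Disjoint (seg p) (seg q)) ∧
    ∃ u, u ∉ T.biUnion seg ∧ X = insert u (T.biUnion seg)

/-- `i 1 < i 2 < ⋯ < i (2 s)` is the sequence `i_*(B)`, that is, `s = |B⁰|` and
`B⁰ = {{i 1, i (2 s)}, {i 2, i (2 s - 1)}, …, {i s, i (s + 1)}}`. The values of `i` outside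
`[1, 2 s]` play no role. -/
def IsStarSeq (B : Pairs) (i : ℕ → ℕ) : Prop :=
  StrictMonoOn i (Set.Icc 1 (2 * (even B).card)) ∧
  even B = (Finset.Icc 1 (even B).card).image
    fun k => s(i k, i (2 * (even B).card + 1 - k))

/-- `*𝒫_N`. -/
def starP (N : ℕ) : Set Pairs :=
  {B | B ∈ P N ∧
    (∀ i j, i < j → s(i, j) ∈ odd B → Covered0 (odd B) (Finset.Icc (i + 1) (j - 1))) ∧
    ∃ i, IsStarSeq B i ∧
      ∀ k, 1 ≤ k → k + 1 ≤ 2 * (even B).card → k ≠ (even B).card →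
        Covered0 (odd B) (Finset.Icc (i k + 1) (i (k + 1) - 1))}

/-- Condition (I): `B⁰` is empty, or both outer intervals are `0`-covered. -/
def CondI (N : ℕ) (B : Pairs) : Prop :=
  (even B).card = 0 ∨ ∃ i, IsStarSeq B i ∧
    Covered0 (odd B) (Finset.Icc 1 (i 1 - 1)) ∧
    Covered0 (odd B) (Finset.Icc (i (2 * (even B).card) + 1) N)

/-- Condition (II)(i), for the sequence `i = i_*(B)`. -/
def CaseLeft (N : ℕ) (B : Pairs) (i : ℕ → ℕ) : Prop :=
  Covered1 (odd B) (Finset.Icc 1 (i 1 - 1)) ∧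
  Covered0 (odd B) (Finset.Icc (i (2 * (even B).card) + 1) (N - 1))

/-- Condition (II)(ii), for the sequence `i = i_*(B)`. -/
def CaseRight (N : ℕ) (B : Pairs) (i : ℕ → ℕ) : Prop :=
  Covered0 (odd B) (Finset.Icc 1 (i 1 - 1)) ∧
  Covered1 (odd B) (Finset.Icc (i (2 * (even B).card) + 1) (N - 1))

/-- Condition (II). -/
def CondII (N : ℕ) (B : Pairs) : Prop :=
  N ∉ supp B ∧
  ((even B).card = 0 ∨
    (Odd (even B).card ∧ ∃ i, IsStarSeq B i ∧ (CaseLeft N B i ∨ CaseRight N B i)))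

/-- Condition (III). -/
def CondIII (N : ℕ) (B : Pairs) : Prop :=
  CondI N B ∧
  (Even (even B).card → ∃ i, Even i ∧ s(i, N) ∈ B) ∧
  (Odd (even B).card → ∃ i, Odd i ∧ s(i, N) ∈ B)

/-- `𝒳_{N-2}^+`. -/
def XPlus (N : ℕ) : Set Pairs := {B | B ∈ starP N ∧ CondII N B}

/-- `𝒳_{N-2}^-`. -/
def XMinus (N : ℕ) : Set Pairs := {B | B ∈ starP N ∧ CondIII N B}

/-- `𝒳_{N-2}`. -/
def X (N : ℕ) : Set Pairs := XPlus N ∪ XMinus N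

/-- `u` has the defining property of `u_B` (for `B ∈ 𝒳_{N-2}^+` with `|B⁰|` odd). -/
def IsU (N : ℕ) (B : Pairs) (u : ℕ) : Prop :=
  ∃ i, IsStarSeq B i ∧
    ((CaseLeft N B i ∧ u ∈ Finset.Icc 1 (i 1 - 1) ∧
        Covered0 (odd B) (Finset.Icc 1 (u - 1)) ∧
        Covered0 (odd B) (Finset.Icc (u + 1) (i 1 - 1))) ∨
      (CaseRight N B i ∧ u ∈ Finset.Icc (i (2 * (even B).card) + 1) (N - 1) ∧
        Covered0 (odd B) (Finset.Icc (i (2 * (even B).card) + 1) (u - 1)) ∧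
        Covered0 (odd B) (Finset.Icc (u + 1) (N - 1))))

/-- `u_B`. It is used only for `B ∈ 𝒳_{N-2}^+` with `|B⁰|` odd, where exactly one `u` satisfies
`IsU N B u`. -/
noncomputable def uB (N : ℕ) (B : Pairs) : ℕ := sInf {u | IsU N B u}

/-- `𝒳_{N-2}^{t,+}`, for an even integer `t`. -/
def XPlusT (N : ℕ) (t : ℤ) : Set Pairs :=
  {B | B ∈ XPlus N ∧
    ((t = 0 ∧ (even B).card = 0) ∨
     (0 < t ∧ ((even B).card : ℤ) = t - 1 ∧ Odd (uB N B)) ∨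
     (t < 0 ∧ ((even B).card : ℤ) = -t - 1 ∧ Even (uB N B)))}

/-- `𝒳_{N-2}^{t,-}`, for an even integer `t`. -/
def XMinusT (N : ℕ) (t : ℤ) : Set Pairs :=
  {B | B ∈ XMinus N ∧
    ((t = 0 ∧ (even B).card = 0) ∨
     (0 < t ∧ ((even B).card : ℤ) = t ∧ ∃ i, Even i ∧ s(i, N) ∈ B) ∨
     (t < 0 ∧ ((even B).card : ℤ) = -t - 1 ∧ ∃ i, Odd i ∧ s(i, N) ∈ B))}

/-- `'𝒳_{N-2}^{0,+}`. -/
def XPrimePlusZero (N : ℕ) : Set Pairs := {B | B ∈ XPlusT N 0 ∧ N - 1 ∉ supp B}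

/-- A finite set of natural numbers as a vector over `F = ℤ/2ℤ` (its indicator function). Sums of
vectors correspond to symmetric differences of sets, see `vec_symmDiff` and `vec_injective`. -/
def vec (Y : Finset ℕ) : ℕ → ZMod 2 := fun h => if h ∈ Y then 1 else 0

theorem vec_injective : Function.Injective vec := by
  intro Y Z h
  ext a
  have := congrFun h a
  by_cases hY : a ∈ Y <;> by_cases hZ : a ∈ Z <;> simp_all [vec]

theorem vec_symmDiff (Y Z : Finset ℕ) : vec (Y ∆ Z) = vec Y + vec Z := by
  funext a
  by_cases hY : a ∈ Y <;> by_cases hZ : a ∈ Z <;>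
    simp [vec, hY, hZ, Finset.mem_symmDiff, show (1 : ZMod 2) + 1 = 0 from rfl]

/-- `[[{i, j}]]` for `i < j`: it is `[i, j]` if `j - i` is odd, and `[j, N] ∪ [1, i]` if `j - i` is
even. -/
def dbl (N : ℕ) (X : Sym2 ℕ) : Finset ℕ :=
  if Odd (X.sup - X.inf) then Finset.Icc X.inf X.sup
  else Finset.Icc X.sup N ∪ Finset.Icc 1 X.inf

open Classical in
/-- `'ε(B)`, for `B ∈ 𝒳_{N-2}`. -/
noncomputable def eps' (N : ℕ) (B : Pairs) : ℕ → ZMod 2 :=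
  ∑ X ∈ B, vec (dbl N X) +
    if B ∈ XPlus N ∧ Odd (even B).card then
      if Even (uB N B) then vec (Finset.Icc (uB N B) N)
      else vec (Finset.Icc N N) + vec (Finset.Icc 1 (uB N B))
    else 0

/-- `<B>`: the `F`-span of the pairs in `B`. -/
def span (B : Pairs) : Submodule (ZMod 2) (ℕ → ZMod 2) :=
  Submodule.span (ZMod 2) ((fun X : Sym2 ℕ => vec X.toFinset) '' (B : Set (Sym2 ℕ)))

/-- `B' ⪯ B`: there is a chain `B' = B_0, B_1, …, B_h = B` in `𝒳_{N-2}`, `h ≥ 0`, with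
`'ε(B_k) ∈ <B_{k+1}>` for `0 ≤ k < h`. -/
def Prec (N : ℕ) (B' B : Pairs) : Prop :=
  Relation.ReflTransGen
    (fun A C : Pairs => A ∈ X N ∧ C ∈ X N ∧ eps' N A ∈ span C) B' B

end PairSets

/-! The proof rests on one integer invariant. For a subset `g` of `[1, N]`, `signedCard` counts its
even elements minus its odd ones.

If `g` lies in the span of `B`, each odd pair contributes `0` and each chosen even pair `{i_k,
i_{2s+1-k}}` contributes `±2`. The gaps between consecutive `i_k`, `k ≤ s`, have even length, so
these signs alternate. Hence the count is `2 (-1)^{i_1} c` with `-⌊s/2⌋ ≤ c ≤ ⌈s/2⌉`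
(`IsStar.signedCard_bounds`).

The vector `'ε(B)` itself lies in this range: it is constant on pairs and vanishes off `supp B`, the
term `δ_B` serving to cancel the values at `u_B` and `N`. It takes the value `s + 1 - k` mod 2 at
`i_k`, so it selects every second even pair, including the innermost one. All selected pairs have
the same sign, and the count has the largest possible absolute value. It equals the degree `t`
(`IsStar.hasDegree`). For `s` odd the opposite extreme is smaller by `2`, so `-t` is not attained;
`t < 0` forces `s` odd.

Thus along a chain `|t|` cannot drop, and a negative `t` is never preceded by `-t`
(`HasDegree.of_prec`); this gives statements 1 and 3. In statement 2 all degrees are `0`, so there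
are no even pairs, and the largest element of `supp A` survives in `'ε(A)`. It must therefore lie in
`supp B`, which excludes `N` and `N - 1`. -/

namespace PairSets

open Finset

variable {N : ℕ} {B : Pairs} {i : ℕ → ℕ}

/-! ### Pairs, non-crossing, and covered sets -/

theorem exists_lt_of_mem (hB : B ∈ P N) {X : Sym2 ℕ} (hX : X ∈ B) :
    ∃ i j, i < j ∧ X = s(i, j) ∧ 1 ≤ i ∧ j ≤ N := by
  have key : ∀ i j : ℕ, i < j → s(i, j) ∈ B → 1 ≤ i ∧ j ≤ N := by
    intro i j _ h
    have h2 := (hB.1 _ h).2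
    exact ⟨(mem_Icc.1 (h2 (Sym2.mem_toFinset.2 (Sym2.mem_mk_left i j)))).1,
      (mem_Icc.1 (h2 (Sym2.mem_toFinset.2 (Sym2.mem_mk_right i j)))).2⟩
  induction X with | _ i j
  have hne : i ≠ j := by simpa using (hB.1 _ hX).1
  rcases lt_or_gt_of_ne hne with h | h
  · exact ⟨i, j, h, rfl, key i j h hX⟩
  · rw [Sym2.eq_swap] at hX
    exact ⟨j, i, h, Sym2.eq_swap, key j i h hX⟩

theorem eq_of_mem (hB : B ∈ P N) {X Y : Sym2 ℕ} (hX : X ∈ B) (hY : Y ∈ B) {h : ℕ}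
    (h1 : h ∈ X) (h2 : h ∈ Y) : X = Y := by
  by_contra hne
  exact disjoint_left.1 (hB.2 X hX Y hY hne) (Sym2.mem_toFinset.2 h1) (Sym2.mem_toFinset.2 h2)

theorem inf_of_lt {i j : ℕ} (h : i < j) : s(i, j).inf = i := by simp [h.le]

theorem sup_of_lt {i j : ℕ} (h : i < j) : s(i, j).sup = j := by simp [h.le]

theorem mem_odd {i j : ℕ} (h : i < j) : s(i, j) ∈ odd B ↔ s(i, j) ∈ B ∧ Odd (j - i) := by
  simp [odd, h.le]

theorem mem_even {i j : ℕ} (h : i < j) : s(i, j) ∈ even B ↔ s(i, j) ∈ B ∧ Even (j - i) := by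
  simp [even, h.le]

theorem mem_seg {i j h : ℕ} (hij : i < j) : h ∈ seg s(i, j) ↔ i ≤ h ∧ h ≤ j := by
  simp [seg, hij.le]

theorem odd_subset : odd B ⊆ B := filter_subset _ _

theorem even_subset : even B ⊆ B := filter_subset _ _

theorem mem_supp {h : ℕ} : h ∈ supp B ↔ ∃ X ∈ B, h ∈ X := by simp [supp]

theorem pair_eq (hB : B ∈ P N) {a b c d h : ℕ} (hab : a < b) (hcd : c < d)
    (h1 : s(a, b) ∈ B) (h2 : s(c, d) ∈ B) (h3 : h = a ∨ h = b) (h4 : h = c ∨ h = d) :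
    a = c ∧ b = d := by
  have := eq_of_mem hB h1 h2 (h := h) (by simpa using h3) (by simpa using h4)
  rcases Sym2.eq_iff.1 this with h | h <;> omega

/-- The interior of every pair in `B¹` is `0`-covered. -/
def InteriorCovered (B : Pairs) : Prop :=
  ∀ i j, i < j → s(i, j) ∈ odd B → Covered0 (odd B) (Icc (i + 1) (j - 1))

theorem Covered0.exists_pair (hB : B ∈ P N) {Z : Finset ℕ} (hZ : Covered0 (odd B) Z) {h : ℕ}
    (hh : h ∈ Z) : ∃ c d, c < d ∧ s(c, d) ∈ odd B ∧ c ≤ h ∧ h ≤ d ∧ ∀ x, c ≤ x → x ≤ d → x ∈ Z := by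
  obtain ⟨T, hT, -, rfl⟩ := hZ
  obtain ⟨r, hr, hhr⟩ := mem_biUnion.1 hh
  obtain ⟨c, d, hcd, rfl, -, -⟩ := exists_lt_of_mem hB (odd_subset (hT hr))
  rw [mem_seg hcd] at hhr
  exact ⟨c, d, hcd, hT hr, hhr.1, hhr.2, fun x h1 h2 =>
    mem_biUnion.2 ⟨_, hr, (mem_seg hcd).2 ⟨h1, h2⟩⟩⟩

/-- Descent: the end `b` lies inside `(i, j)`, hence in a shorter odd interval `[c, d]` strictly
inside `[i, j]`, and `(a, b)` crosses that one as well. -/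
theorem not_crossing (hB : B ∈ P N) (hO : InteriorCovered B) {a b i j : ℕ} (hab : a < b)
    (hij : i < j) (h1 : s(a, b) ∈ odd B) (h2 : s(i, j) ∈ odd B) (h3 : a < i) (h4 : i < b)
    (h5 : b < j) : False := by
  obtain ⟨c, d, hcd, hr, hcb, hbd, hsub⟩ :=
    (hO i j hij h2).exists_pair hB (h := b) (mem_Icc.2 (by omega))
  have hc := mem_Icc.1 (hsub c le_rfl hcd.le)
  have hd := mem_Icc.1 (hsub d hcd.le le_rfl)
  -- A shared end would make the two pairs equal, but `a < i < c`.
  have hne : ¬ (b = c ∨ b = d) := fun h => by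
    have := pair_eq hB hab hcd (odd_subset h1) (odd_subset hr) (Or.inr rfl) h
    omega
  exact not_crossing hB hO hab hcd h1 hr (by omega) (by omega) (by omega)
termination_by j - i

/-- The covering interval around one end cannot be crossed, so it contains the other end too. -/
theorem Covered0.mem_iff (hB : B ∈ P N) (hO : InteriorCovered B) {Z : Finset ℕ}
    (hZ : Covered0 (odd B) Z) {a b : ℕ} (hab : a < b) (h1 : s(a, b) ∈ odd B) :
    a ∈ Z ↔ b ∈ Z := by
  constructor <;> intro h
  · obtain ⟨c, d, hcd, hr, hc, hd, hsub⟩ := hZ.exists_pair hB h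
    by_cases he : a = c ∨ a = d
    · have := pair_eq hB hab hcd (odd_subset h1) (odd_subset hr) (Or.inl rfl) he
      exact hsub b (by omega) (by omega)
    · by_cases hbd : b ≤ d
      · exact hsub b (by omega) hbd
      · exact (not_crossing hB hO hcd hab hr h1 (by omega) (by omega) (by omega)).elim
  · obtain ⟨c, d, hcd, hr, hc, hd, hsub⟩ := hZ.exists_pair hB h
    by_cases he : b = c ∨ b = d
    · have := pair_eq hB hab hcd (odd_subset h1) (odd_subset hr) (Or.inr rfl) he
      exact hsub a (by omega) (by omega)
    · by_cases hac : c ≤ a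
      · exact hsub a hac (by omega)
      · exact (not_crossing hB hO hab hcd h1 hr (by omega) (by omega) (by omega)).elim

/-- Descent on nested intervals: an interior point lies in a strictly shorter odd interval, until it
becomes an end. Consequently points outside the odd support avoid every odd interval. -/
theorem mem_supp_of_mem_seg (hB : B ∈ P N) (hO : InteriorCovered B) {c d h : ℕ} (hcd : c < d)
    (hr : s(c, d) ∈ odd B) (h1 : c ≤ h) (h2 : h ≤ d) : h ∈ supp (odd B) := by
  by_cases he : h = c ∨ h = d
  · exact mem_supp.2 ⟨_, hr, by simpa using he⟩
  · obtain ⟨c', d', hcd', hr', hc, hd, hsub⟩ :=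
      (hO c d hcd hr).exists_pair hB (h := h) (mem_Icc.2 (by omega))
    have hc' := mem_Icc.1 (hsub c' le_rfl hcd'.le)
    have hd' := mem_Icc.1 (hsub d' hcd'.le le_rfl)
    exact mem_supp_of_mem_seg hB hO hcd' hr' hc hd
termination_by d - c

theorem Covered0.mem_supp (hB : B ∈ P N) (hO : InteriorCovered B) {Z : Finset ℕ}
    (hZ : Covered0 (odd B) Z) {h : ℕ} (hh : h ∈ Z) : h ∈ supp (odd B) := by
  obtain ⟨c, d, hcd, hr, hc, hd, -⟩ := hZ.exists_pair hB hh
  exact mem_supp_of_mem_seg hB hO hcd hr hc hd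

theorem disjoint_supp (hB : B ∈ P N) {h : ℕ} (h1 : h ∈ supp (odd B)) : h ∉ supp (even B) := by
  intro h2
  obtain ⟨X, hX, hhX⟩ := PairSets.mem_supp.1 h1
  obtain ⟨Y, hY, hhY⟩ := PairSets.mem_supp.1 h2
  obtain rfl := eq_of_mem hB (odd_subset hX) (even_subset hY) hhX hhY
  have h3 := (mem_filter.1 hX).2
  have h4 := (mem_filter.1 hY).2
  exact (Nat.not_even_iff_odd.2 h3) h4

theorem even_card_biUnion_seg (hB : B ∈ P N) {T : Pairs} (hT : T ⊆ odd B)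
    (hd : ∀ p ∈ T, ∀ q ∈ T, p ≠ q → Disjoint (seg p) (seg q)) : Even (T.biUnion seg).card := by
  rw [card_biUnion hd]
  refine even_sum _ fun p hp => ?_
  obtain ⟨c, d, hcd, rfl, -, -⟩ := exists_lt_of_mem hB (odd_subset (hT hp))
  have := (mem_odd hcd).1 (hT hp)
  rw [seg, inf_of_lt hcd, sup_of_lt hcd, Nat.card_Icc]
  rcases this.2 with ⟨m, hm⟩
  exact ⟨m + 1, by omega⟩

theorem Covered0.even_card (hB : B ∈ P N) {Z : Finset ℕ} (hZ : Covered0 (odd B) Z) :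
    Even Z.card := by
  obtain ⟨T, hT, hd, rfl⟩ := hZ
  exact even_card_biUnion_seg hB hT hd

/-- A `1`-covered interval splits into a point and two `0`-covered intervals. -/
theorem Covered1.exists_split {x y : ℕ} (hx : 1 ≤ x)
    (hZ : Covered1 (odd B) (Icc x y)) :
    ∃ u ∈ Icc x y, Covered0 (odd B) (Icc x (u - 1)) ∧ Covered0 (odd B) (Icc (u + 1) y) := by
  obtain ⟨T, hT, hd, u, hu, h⟩ := hZ
  have huZ : u ∈ Icc x y := by rw [h]; exact mem_insert_self _ _
  have hxy := mem_Icc.1 huZ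
  have mem : ∀ z, z ∈ Icc x y ↔ z = u ∨ ∃ p ∈ T, z ∈ seg p := by
    intro z; rw [h, mem_insert, mem_biUnion]
  have huT : ∀ p ∈ T, u ∉ seg p := fun p hp hup => hu (mem_biUnion.2 ⟨p, hp, hup⟩)
  refine ⟨u, huZ, ⟨T.filter fun p => p.sup < u, (filter_subset _ _).trans hT,
    fun p hp q hq => hd p (filter_subset _ _ hp) q (filter_subset _ _ hq), ?_⟩,
    ⟨T.filter fun p => u < p.inf, (filter_subset _ _).trans hT,
    fun p hp q hq => hd p (filter_subset _ _ hp) q (filter_subset _ _ hq), ?_⟩⟩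
  · ext z
    simp only [mem_biUnion, mem_filter]
    constructor
    · intro hz
      have hz' := mem_Icc.1 hz
      by_cases hu0 : z = u
      · omega
      rcases (mem z).1 (mem_Icc.2 (by omega)) with h1 | ⟨p, hp, hzp⟩
      · exact (hu0 h1).elim
      · refine ⟨p, ⟨hp, ?_⟩, hzp⟩
        have := huT p hp
        simp only [seg, mem_Icc] at this hzp
        omega
    · rintro ⟨p, ⟨hp, hpu⟩, hzp⟩
      have h1 := mem_Icc.1 ((mem z).2 (Or.inr ⟨p, hp, hzp⟩))
      simp only [seg, mem_Icc] at hzp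
      exact mem_Icc.2 (by omega)
  · ext z
    simp only [mem_biUnion, mem_filter]
    constructor
    · intro hz
      have hz' := mem_Icc.1 hz
      rcases (mem z).1 (mem_Icc.2 (by omega)) with h1 | ⟨p, hp, hzp⟩
      · omega
      · refine ⟨p, ⟨hp, ?_⟩, hzp⟩
        have := huT p hp
        simp only [seg, mem_Icc] at this hzp
        omega
    · rintro ⟨p, ⟨hp, hpu⟩, hzp⟩
      have h1 := mem_Icc.1 ((mem z).2 (Or.inr ⟨p, hp, hzp⟩))
      simp only [seg, mem_Icc] at hzp
      exact mem_Icc.2 (by omega)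

/-! ### The star sequence -/

/-- `B ∈ *𝒫_N`, with its sequence `i_*(B)`. -/
structure IsStar (N : ℕ) (B : Pairs) (i : ℕ → ℕ) : Prop where
  mem_P : B ∈ P N
  interior : InteriorCovered B
  seq : IsStarSeq B i
  cov : ∀ k, 1 ≤ k → k + 1 ≤ 2 * (even B).card → k ≠ (even B).card →
    Covered0 (odd B) (Icc (i k + 1) (i (k + 1) - 1))

theorem IsStarSeq.lt (h : IsStarSeq B i) {k l : ℕ} (hk : 1 ≤ k) (hkl : k < l)
    (hl : l ≤ 2 * (even B).card) : i k < i l :=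
  h.1 ⟨hk, by omega⟩ ⟨by omega, hl⟩ hkl

theorem IsStarSeq.le_iff (h : IsStarSeq B i) {k l : ℕ} (hk : 1 ≤ k) (hk' : k ≤ 2 * (even B).card)
    (hl : 1 ≤ l) (hl' : l ≤ 2 * (even B).card) : i k ≤ i l ↔ k ≤ l :=
  h.1.le_iff_le ⟨hk, hk'⟩ ⟨hl, hl'⟩

theorem IsStarSeq.pair_mem (h : IsStarSeq B i) {k : ℕ} (hk : 1 ≤ k) (hk' : k ≤ (even B).card) :
    s(i k, i (2 * (even B).card + 1 - k)) ∈ even B := by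
  exact (Finset.ext_iff.1 h.2 _).2 (mem_image.2 ⟨k, mem_Icc.2 ⟨hk, hk'⟩, rfl⟩)

theorem IsStarSeq.mem_supp (h : IsStarSeq B i) {k : ℕ} (hk : 1 ≤ k)
    (hk' : k ≤ 2 * (even B).card) : i k ∈ supp (even B) := by
  rw [PairSets.mem_supp]
  by_cases h1 : k ≤ (even B).card
  · exact ⟨_, h.pair_mem hk h1, Sym2.mem_mk_left _ _⟩
  · refine ⟨_, h.pair_mem (k := 2 * (even B).card + 1 - k) (by omega) (by omega), ?_⟩
    rw [show 2 * (even B).card + 1 - (2 * (even B).card + 1 - k) = k by omega]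
    exact Sym2.mem_mk_right _ _

theorem IsStarSeq.exists_of_mem_supp (h : IsStarSeq B i) {x : ℕ} (hx : x ∈ supp (even B)) :
    ∃ k, 1 ≤ k ∧ k ≤ 2 * (even B).card ∧ x = i k := by
  obtain ⟨X, hX, hxX⟩ := PairSets.mem_supp.1 hx
  rw [h.2] at hX
  obtain ⟨k, hk, rfl⟩ := mem_image.1 hX
  have hk := mem_Icc.1 hk
  rcases Sym2.mem_iff.1 hxX with h1 | h1
  · exact ⟨k, by omega, by omega, h1⟩
  · exact ⟨_, by omega, by omega, h1⟩

/-- The ends are the minimum and maximum of the support of `even B`. This reconciles the sequences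
supplied by separate existential statements about the same `B`. -/
theorem IsStarSeq.ends_eq {i' : ℕ → ℕ} (h : IsStarSeq B i) (h' : IsStarSeq B i')
    (hs : 0 < (even B).card) :
    i 1 = i' 1 ∧ i (2 * (even B).card) = i' (2 * (even B).card) := by
  have key : ∀ {j j' : ℕ → ℕ}, IsStarSeq B j → IsStarSeq B j' →
      j' 1 ≤ j 1 ∧ j (2 * (even B).card) ≤ j' (2 * (even B).card) := by
    intro j j' h h'
    obtain ⟨k, h1, h2, h3⟩ := h'.exists_of_mem_supp (h.mem_supp le_rfl (by omega))
    obtain ⟨l, h4, h5, h6⟩ := h'.exists_of_mem_supp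
      (h.mem_supp (k := 2 * (even B).card) (by omega) le_rfl)
    rw [h3, h6, h'.le_iff le_rfl (by omega) h1 h2, h'.le_iff h4 h5 (by omega) le_rfl]
    exact ⟨h1, h5⟩
  have h1 := key h h'
  have h2 := key h' h
  omega

namespace IsStar

variable (S : IsStar N B i)
include S

theorem even_sub {k : ℕ} (hk : 1 ≤ k) (hk' : k ≤ (even B).card) :
    Even (i (2 * (even B).card + 1 - k) - i k) :=
  ((mem_even (S.seq.lt hk (by omega) (by omega))).1 (S.seq.pair_mem hk hk')).2

/-- Each gap is `0`-covered, so it has even length and the parity flips. The argument stops at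
`i_s`, since the middle gap is unconstrained. -/
theorem parity {k : ℕ} (hk : k < (even B).card) : Even (i (k + 1)) ↔ Even (i 1 + k) := by
  induction k with
  | zero => simp
  | succ k ih =>
    have h1 := ih (by omega)
    have h2 := (S.cov (k + 1) (by omega) (by omega) (by omega)).even_card S.mem_P
    have h3 := S.seq.lt (k := k + 1) (l := k + 2) (by omega) (by omega) (by omega)
    rw [Nat.card_Icc] at h2
    grind

theorem mem_Icc_of_mem_supp {h : ℕ} (hh : h ∈ supp B) : 1 ≤ h ∧ h ≤ N := by
  obtain ⟨X, hX, hhX⟩ := mem_supp.1 hh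
  exact mem_Icc.1 ((S.mem_P.1 X hX).2 (Sym2.mem_toFinset.2 hhX))

theorem not_mem_seg {a b h : ℕ} (hab : a < b) (hp : s(a, b) ∈ odd B) (hh : h ∉ supp (odd B)) :
    ¬ (a ≤ h ∧ h ≤ b) := fun h1 =>
  hh (mem_supp_of_mem_seg S.mem_P S.interior hab hp h1.1 h1.2)

theorem seq_not_mem_supp {k : ℕ} (hk : 1 ≤ k) (hk' : k ≤ 2 * (even B).card) :
    i k ∉ supp (odd B) := fun h =>
  disjoint_supp S.mem_P h (S.seq.mem_supp hk hk')

theorem seq_mem_Icc {k : ℕ} (hk : 1 ≤ k) (hk' : k ≤ 2 * (even B).card) :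
    1 ≤ i k ∧ i k ≤ N := by
  obtain ⟨X, hX, hx⟩ := mem_supp.1 (S.seq.mem_supp hk hk')
  exact S.mem_Icc_of_mem_supp (mem_supp.2 ⟨X, even_subset hX, hx⟩)

/-- An element between the ends of the star sequence that is not in the support lies between
`i_s` and `i_{s+1}`. -/
theorem mid_of_not_mem_supp (hs : 0 < (even B).card) {h : ℕ} (h1 : i 1 ≤ h) (h2 : h ≤ i (2 * (even B).card))
    (hh : h ∉ supp B) :
    i (even B).card < h ∧ h < i ((even B).card + 1) := by
  have hne : ∀ k, 1 ≤ k → k ≤ 2 * (even B).card → h ≠ i k := by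
    rintro k hk hk' rfl
    obtain ⟨X, hX, hx⟩ := mem_supp.1 (S.seq.mem_supp hk hk')
    exact hh (mem_supp.2 ⟨X, even_subset hX, hx⟩)
  have hcov : ∀ k, 1 ≤ k → k + 1 ≤ 2 * (even B).card → k ≠ (even B).card →
      ¬ (i k ≤ h ∧ h ≤ i (k + 1)) := by
    intro k hk hk' hks hle
    have := hne k hk (by omega)
    have := hne (k + 1) (by omega) hk'
    obtain ⟨X, hX, hx⟩ := mem_supp.1 ((S.cov k hk hk' hks).mem_supp S.mem_P S.interior
      (h := h) (mem_Icc.2 (by omega)))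
    exact hh (mem_supp.2 ⟨X, odd_subset hX, hx⟩)
  have up : ∀ k, 1 ≤ k → k ≤ (even B).card → i k < h := by
    intro k hk
    induction k, hk using Nat.le_induction with
    | base => intro _; have := hne 1 le_rfl (by omega); omega
    | succ k hk ih =>
      intro hk'
      have := ih (by omega)
      have := hcov k hk (by omega) (by omega)
      omega
  have down : ∀ k, k < (even B).card → h < i (2 * (even B).card - k) := by
    intro k
    induction k with
    | zero => intro _; have := hne (2 * (even B).card) (by omega) le_rfl; simp; omega
    | succ k ih =>
      intro hk'
      have h1 := ih (by omega)
      have h2 := hcov (2 * (even B).card - (k + 1)) (by omega) (by omega) (by omega)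
      rw [show 2 * (even B).card - (k + 1) + 1 = 2 * (even B).card - k by omega] at h2
      omega
  have h3 := down ((even B).card - 1) (by omega)
  rw [show 2 * (even B).card - ((even B).card - 1) = (even B).card + 1 by omega] at h3
  exact ⟨up _ hs le_rfl, h3⟩

end IsStar

/-! ### The signed count on the span of `B` -/

/-- The signed count of the elements of a subset of `[1, N]`: even elements count `1`, odd elements
count `-1`. -/
def signedCard (N : ℕ) (g : ℕ → ZMod 2) : ℤ := ∑ h ∈ Icc 1 N, (-1) ^ h * ((g h).val : ℤ)

/-- `g` is supported on `supp B` and constant on the pairs in `B`. -/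
def IsPairwiseConst (B : Pairs) (g : ℕ → ZMod 2) : Prop :=
  (∀ h, h ∉ supp B → g h = 0) ∧ ∀ X ∈ B, ∀ a ∈ X, ∀ b ∈ X, g a = g b

theorem isPairwiseConst_of_mem_span (hB : B ∈ P N) {g : ℕ → ZMod 2} (hg : g ∈ span B) :
    IsPairwiseConst B g := by
  induction hg using Submodule.span_induction with
  | mem x hx =>
    obtain ⟨X, hX, rfl⟩ := hx
    refine ⟨fun h hh => ?_, fun Y hY a ha b hb => ?_⟩
    · have : h ∉ X := fun h1 => hh (mem_supp.2 ⟨X, hX, h1⟩)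
      simp [vec, this]
    · have : a ∈ X ↔ b ∈ X := by
        constructor <;> intro h1
        · rwa [eq_of_mem hB hX hY h1 ha]
        · rwa [eq_of_mem hB hX hY h1 hb]
      simp [vec, this]
  | zero => exact ⟨fun _ _ => rfl, fun _ _ _ _ _ _ => rfl⟩
  | add x y _ _ hx hy =>
    exact ⟨fun h hh => by simp [hx.1 h hh, hy.1 h hh], fun X hX a ha b hb => by
      simp [hx.2 X hX a ha b hb, hy.2 X hX a ha b hb]⟩
  | smul c x _ hx =>
    exact ⟨fun h hh => by simp [hx.1 h hh], fun X hX a ha b hb => by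
      simp [hx.2 X hX a ha b hb]⟩

theorem IsStar.signedCard_eq (S : IsStar N B i) {g : ℕ → ZMod 2} (hg : IsPairwiseConst B g) :
    signedCard N g =
      2 * (-1) ^ i 1 * ∑ k ∈ range (even B).card, (-1) ^ k * ((g (i (k + 1))).val : ℤ) := by
  have h1 : signedCard N g = ∑ h ∈ supp B, (-1) ^ h * ((g h).val : ℤ) := by
    refine (sum_subset (fun h hh => mem_Icc.2 (S.mem_Icc_of_mem_supp hh)) fun h _ hh => ?_).symm
    simp [hg.1 h hh]
  have h2 : ∀ {a b : ℕ}, a < b → ∑ h ∈ (s(a, b) : Sym2 ℕ).toFinset, (-1) ^ h * ((g h).val : ℤ) =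
      (-1) ^ a * ((g a).val : ℤ) + (-1) ^ b * ((g b).val : ℤ) := by
    intro a b hab
    rw [Sym2.toFinset_mk_eq, sum_pair hab.ne]
  have hodd : ∀ X ∈ odd B, ∑ h ∈ X.toFinset, (-1) ^ h * ((g h).val : ℤ) = 0 := by
    intro X hX
    obtain ⟨a, b, hab, rfl, -, -⟩ := exists_lt_of_mem S.mem_P (odd_subset hX)
    obtain ⟨m, hm⟩ := ((mem_odd hab).1 hX).2
    rw [h2 hab, hg.2 _ (odd_subset hX) a (Sym2.mem_mk_left _ _) b (Sym2.mem_mk_right _ _),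
      show b = a + (2 * m + 1) by omega, pow_add, pow_succ, pow_mul]
    simp
  have hsplit : B = even B ∪ odd B := by
    ext X
    simp only [even, odd, mem_union, mem_filter]
    have := Nat.even_or_odd (X.sup - X.inf)
    tauto
  have hdisj : Disjoint (even B) (odd B) := by
    rw [disjoint_left]
    intro X h3 h4
    exact (Nat.not_even_iff_odd.2 (mem_filter.1 h4).2) (mem_filter.1 h3).2
  rw [h1, supp, sum_biUnion S.mem_P.2]
  nth_rewrite 1 [hsplit]
  rw [sum_union hdisj, sum_eq_zero hodd, add_zero]
  nth_rewrite 1 [S.seq.2]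
  -- Reindexes the right-hand side from `0, …, s - 1` to `1, …, s`, to match the enumeration of the
  -- even pairs.
  have hshift := sum_Ico_add' (fun k => 2 * (-1 : ℤ) ^ i 1 *
    ((-1) ^ (k - 1) * ((g (i k)).val : ℤ))) 0 (even B).card 1
  simp only [Nat.add_sub_cancel] at hshift
  rw [sum_image, mul_sum, range_eq_Ico, hshift]
  · refine sum_congr (by ext; simp) fun k hk => ?_
    have hk := mem_Icc.1 hk
    have hlt := S.seq.lt (k := k) (l := 2 * (even B).card + 1 - k) hk.1 (by omega) (by omega)
    have hm := S.seq.pair_mem hk.1 hk.2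
    obtain ⟨m, hm'⟩ := S.even_sub hk.1 hk.2
    rw [h2 hlt, ← hg.2 _ (even_subset hm) _ (Sym2.mem_mk_left _ _) _ (Sym2.mem_mk_right _ _)]
    have hp := S.parity (k := k - 1) (by omega)
    rw [Nat.sub_add_cancel hk.1] at hp
    have e1 : (-1 : ℤ) ^ i (2 * (even B).card + 1 - k) = (-1) ^ i k := by
      rw [show i (2 * (even B).card + 1 - k) = i k + 2 * m by omega, pow_add, pow_mul]; simp
    have e2 : (-1 : ℤ) ^ i k = (-1) ^ (i 1 + (k - 1)) := by
      rcases Nat.even_or_odd (i k) with he | ho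
      · rw [he.neg_one_pow, (hp.1 he).neg_one_pow]
      · have : Odd (i 1 + (k - 1)) := by
          rw [← Nat.not_even_iff_odd, ← hp, Nat.not_even_iff_odd]; exact ho
        rw [ho.neg_one_pow, this.neg_one_pow]
    rw [e1, e2, pow_add]
    ring
  · intro k hk l hl hkl
    have hk := mem_Icc.1 hk
    have hl := mem_Icc.1 hl
    have hi := S.seq.1.injOn
    rcases Sym2.eq_iff.1 hkl with h3 | h3
    · exact hi ⟨hk.1, by omega⟩ ⟨hl.1, by omega⟩ h3.1
    · have := hi ⟨hk.1, by omega⟩ ⟨by omega, by omega⟩ h3.1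
      omega

theorem alternating_sum_bounds (s : ℕ) {y : ℕ → ℤ} (h0 : ∀ k, 0 ≤ y k) (h1 : ∀ k, y k ≤ 1) :
    -((s / 2 : ℕ) : ℤ) ≤ ∑ k ∈ range s, (-1) ^ k * y k ∧
      ∑ k ∈ range s, (-1) ^ k * y k ≤ (((s + 1) / 2 : ℕ) : ℤ) := by
  induction s with
  | zero => simp
  | succ s ih =>
    rw [sum_range_succ]
    have := h0 s
    have := h1 s
    rcases Nat.even_or_odd s with h | h
    · rw [h.neg_one_pow]
      obtain ⟨m, hm⟩ := h
      omega
    · rw [h.neg_one_pow]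
      obtain ⟨m, hm⟩ := h
      omega

/-- The nonzero terms are those with `k ≡ s - 1` mod 2; they share one sign, so the upper bound of
`alternating_sum_bounds` is attained for `s` odd and the lower one for `s` even. The induction peels
off the first term because `s - k` is invariant under shifting both. -/
theorem alternating_sum_parity (s : ℕ) :
    ∑ k ∈ range s, (-1 : ℤ) ^ k * ((((s - k : ℕ) : ZMod 2).val : ℕ) : ℤ) =
      -(-1) ^ s * ((s + 1) / 2 : ℕ) := by
  induction s with
  | zero => simp
  | succ s ih =>
    rw [sum_range_succ']
    have e : ∑ k ∈ range s, (-1 : ℤ) ^ (k + 1) * ((((s + 1 - (k + 1) : ℕ) : ZMod 2).val : ℕ) : ℤ) =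
        -∑ k ∈ range s, (-1 : ℤ) ^ k * ((((s - k : ℕ) : ZMod 2).val : ℕ) : ℤ) := by
      rw [← sum_neg_distrib]
      exact sum_congr rfl fun k _ => by rw [Nat.add_sub_add_right, pow_succ]; ring
    rw [e, ih, ZMod.val_natCast, pow_succ]
    rcases Nat.even_or_odd s with h | h
    · rw [h.neg_one_pow]
      obtain ⟨m, hm⟩ := h
      simp
      omega
    · rw [h.neg_one_pow]
      obtain ⟨m, hm⟩ := h
      simp
      omega

/-! ### Values of the pair part of `'ε(B)` -/

/-- The part of `'ε(B)` that comes from the pairs in `B`. -/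
def pairSum (N : ℕ) (B : Pairs) : ℕ → ZMod 2 := ∑ X ∈ B, vec (dbl N X)

theorem mem_dbl_odd {a b h : ℕ} (hab : a < b) (ho : Odd (b - a)) :
    h ∈ dbl N s(a, b) ↔ a ≤ h ∧ h ≤ b := by
  simp [dbl, hab.le, ho]

theorem mem_dbl_even {a b h : ℕ} (hab : a < b) (he : Even (b - a)) :
    h ∈ dbl N s(a, b) ↔ (b ≤ h ∧ h ≤ N) ∨ (1 ≤ h ∧ h ≤ a) := by
  simp [dbl, hab.le, Nat.not_odd_iff_even.2 he]

theorem pairSum_congr {a b : ℕ} (h : ∀ X ∈ B, a ∈ dbl N X ↔ b ∈ dbl N X) :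
    pairSum N B a = pairSum N B b := by
  simp only [pairSum, Finset.sum_apply]
  exact sum_congr rfl fun X hX => by simp [vec, h X hX]

theorem pairSum_eq_zero {a : ℕ} (h : ∀ X ∈ B, a ∉ dbl N X) : pairSum N B a = 0 := by
  simp only [pairSum, Finset.sum_apply]
  exact sum_eq_zero fun X hX => by simp [vec, h X hX]

theorem mem_even_or_odd {X : Sym2 ℕ} (hX : X ∈ B) : X ∈ even B ∨ X ∈ odd B := by
  simp only [even, odd, mem_filter, hX, true_and]
  exact Nat.even_or_odd _

namespace IsStar

variable (S : IsStar N B i)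
include S

theorem even_pair_cases {X : Sym2 ℕ} (hX : X ∈ even B) :
    ∃ k, 1 ≤ k ∧ k ≤ (even B).card ∧ X = s(i k, i (2 * (even B).card + 1 - k)) := by
  rw [S.seq.2] at hX
  obtain ⟨k, hk, rfl⟩ := mem_image.1 hX
  exact ⟨k, (mem_Icc.1 hk).1, (mem_Icc.1 hk).2, rfl⟩

theorem mem_dbl_seq {k h : ℕ} (hk : 1 ≤ k) (hk' : k ≤ (even B).card) :
    h ∈ dbl N s(i k, i (2 * (even B).card + 1 - k)) ↔
      (i (2 * (even B).card + 1 - k) ≤ h ∧ h ≤ N) ∨ (1 ≤ h ∧ h ≤ i k) :=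
  mem_dbl_even (S.seq.lt hk (by omega) (by omega)) (S.even_sub hk hk')

theorem not_mem_dbl_of_odd {X : Sym2 ℕ} (hX : X ∈ odd B) {h : ℕ} (hh : h ∉ supp (odd B)) :
    h ∉ dbl N X := by
  obtain ⟨a, b, hab, rfl, -, -⟩ := exists_lt_of_mem S.mem_P (odd_subset hX)
  rw [mem_dbl_odd hab ((mem_odd hab).1 hX).2]
  exact S.not_mem_seg hab hX hh

/-- An odd pair is not separated by an element outside the supports of the odd pairs. -/
theorem le_iff_of_odd {a b h : ℕ} (hab : a < b) (hp : s(a, b) ∈ odd B) (hh : h ∉ supp (odd B)) :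
    (a ≤ h ↔ b ≤ h) ∧ (h ≤ a ↔ h ≤ b) := by
  have h1 := S.not_mem_seg hab hp hh
  have h2 : h ≠ a := by rintro rfl; omega
  have h3 : h ≠ b := by rintro rfl; omega
  omega

/-- No set `[[X]]` separates the ends of an odd pair: its interval contains no `i_k` and crosses no
other odd interval. -/
theorem pairSum_odd {a b : ℕ} (hab : a < b) (hp : s(a, b) ∈ odd B) :
    pairSum N B a = pairSum N B b := by
  refine pairSum_congr fun X hX => ?_
  have ha := S.mem_Icc_of_mem_supp (mem_supp.2 ⟨_, odd_subset hp, Sym2.mem_mk_left a b⟩)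
  have hb := S.mem_Icc_of_mem_supp (mem_supp.2 ⟨_, odd_subset hp, Sym2.mem_mk_right a b⟩)
  rcases mem_even_or_odd hX with h | h
  · obtain ⟨k, hk, hk', rfl⟩ := S.even_pair_cases h
    rw [S.mem_dbl_seq hk hk', S.mem_dbl_seq hk hk']
    have h1 := S.le_iff_of_odd hab hp (S.seq_not_mem_supp hk (by omega))
    have h2 := S.le_iff_of_odd hab hp
      (S.seq_not_mem_supp (k := 2 * (even B).card + 1 - k) (by omega) (by omega))
    omega
  · obtain ⟨c, d, hcd, rfl, -, -⟩ := exists_lt_of_mem S.mem_P hX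
    rw [mem_dbl_odd hcd ((mem_odd hcd).1 h).2, mem_dbl_odd hcd ((mem_odd hcd).1 h).2]
    by_cases he : a = c ∨ a = d
    · have := pair_eq S.mem_P hab hcd (odd_subset hp) hX (Or.inl rfl) he
      omega
    by_cases he' : b = c ∨ b = d
    · have := pair_eq S.mem_P hab hcd (odd_subset hp) hX (Or.inr rfl) he'
      omega
    have h1 : ¬ (a < c ∧ c < b ∧ b < d) := fun h1 =>
      not_crossing S.mem_P S.interior hab hcd hp h h1.1 h1.2.1 h1.2.2
    have h2 : ¬ (c < a ∧ a < d ∧ d < b) := fun h2 =>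
      not_crossing S.mem_P S.interior hcd hab h hp h2.1 h2.2.1 h2.2.2
    omega

/-- Only even pairs matter at `h`. Their sets `[[X]]` grow as the pairs shrink inward, so the ones
containing `h` are the `m` innermost. -/
theorem pairSum_of_not_mem {h m : ℕ} (hh : h ∉ supp (odd B)) (hm : m ≤ (even B).card)
    (hk : ∀ k, 1 ≤ k → k ≤ (even B).card →
      (h ∈ dbl N s(i k, i (2 * (even B).card + 1 - k)) ↔ (even B).card < k + m)) :
    pairSum N B h = m := by
  have h1 : pairSum N B h = ∑ X ∈ even B, vec (dbl N X) h := by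
    simp only [pairSum, Finset.sum_apply]
    refine (sum_subset even_subset fun X hX hX' => ?_).symm
    have := S.not_mem_dbl_of_odd ((mem_even_or_odd hX).resolve_left hX') hh
    simp [vec, this]
  -- The image of the `s` indices is `even B`, which has `s` elements.
  have hinj : Set.InjOn (fun k => s(i k, i (2 * (even B).card + 1 - k)))
      (Icc 1 (even B).card : Finset ℕ) := by
    have := S.seq.2
    exact card_image_iff.1 (by rw [← this]; simp)
  have h2 : ∑ X ∈ even B, vec (dbl N X) h =
      ∑ k ∈ Icc 1 (even B).card, if (even B).card < k + m then (1 : ZMod 2) else 0 := by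
    nth_rewrite 1 [S.seq.2]
    rw [sum_image hinj]
    refine sum_congr rfl fun k hk' => ?_
    have hk' := mem_Icc.1 hk'
    simp only [vec, hk k hk'.1 hk'.2]
  have h3 : (Icc 1 (even B).card).filter (fun k => (even B).card < k + m) =
      Icc ((even B).card + 1 - m) (even B).card := by
    ext k
    simp only [mem_filter, mem_Icc]
    omega
  rw [h1, h2, sum_boole, h3, Nat.card_Icc]
  congr 1
  omega

theorem pairSum_seq {k : ℕ} (hk : 1 ≤ k) (hk' : k ≤ (even B).card) :
    pairSum N B (i k) = ((even B).card + 1 - k : ℕ) ∧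
      pairSum N B (i (2 * (even B).card + 1 - k)) = ((even B).card + 1 - k : ℕ) := by
  constructor
  · refine S.pairSum_of_not_mem (S.seq_not_mem_supp hk (by omega)) (by omega) fun l hl hl' => ?_
    have := S.seq_mem_Icc hk (by omega)
    rw [S.mem_dbl_seq hl hl', S.seq.le_iff (by omega) (by omega) hk (by omega),
      S.seq.le_iff hk (by omega) hl (by omega)]
    omega
  · refine S.pairSum_of_not_mem (S.seq_not_mem_supp (by omega) (by omega)) (by omega)
      fun l hl hl' => ?_
    have := S.seq_mem_Icc (k := 2 * (even B).card + 1 - k) (by omega) (by omega)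
    rw [S.mem_dbl_seq hl hl', S.seq.le_iff (by omega) (by omega) (by omega) (by omega),
      S.seq.le_iff (by omega) (by omega) hl (by omega)]
    omega

theorem pairSum_outer {h : ℕ} (hh : h ∉ supp (odd B)) (h1 : 1 ≤ h) (h2 : h ≤ N)
    (h3 : h < i 1 ∨ i (2 * (even B).card) < h) : pairSum N B h = (even B).card := by
  refine S.pairSum_of_not_mem hh le_rfl fun k hk hk' => ?_
  rw [S.mem_dbl_seq hk hk']
  have := (S.seq.le_iff le_rfl (by omega) hk (by omega)).2 hk
  have := (S.seq.le_iff (k := 2 * (even B).card + 1 - k) (l := 2 * (even B).card)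
    (by omega) (by omega) (by omega) le_rfl).2 (by omega)
  omega

theorem pairSum_mid {h : ℕ} (hh : h ∉ supp (odd B))
    (h3 : (even B).card = 0 ∨ i (even B).card < h ∧ h < i ((even B).card + 1)) :
    pairSum N B h = 0 := by
  have := S.pairSum_of_not_mem (m := 0) hh (by omega) fun k hk hk' => ?_
  · simpa using this
  rw [S.mem_dbl_seq hk hk']
  have := (S.seq.le_iff (l := (even B).card) hk (by omega) (by omega) (by omega)).2 hk'
  have := (S.seq.le_iff (k := (even B).card + 1) (l := 2 * (even B).card + 1 - k)
    (by omega) (by omega) (by omega) (by omega)).2 (by omega)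
  omega

theorem pairSum_of_not_mem_Icc {h : ℕ} (hh : ¬ (1 ≤ h ∧ h ≤ N)) : pairSum N B h = 0 := by
  refine pairSum_eq_zero fun X hX hX' => hh ?_
  obtain ⟨a, b, hab, rfl, h1, h2⟩ := exists_lt_of_mem S.mem_P hX
  rcases mem_even_or_odd hX with h3 | h3
  · have := (mem_dbl_even hab ((mem_even hab).1 h3).2).1 hX'
    omega
  · have := (mem_dbl_odd hab ((mem_odd hab).1 h3).2).1 hX'
    omega

/-- If a function with the right values on the elements outside the support is added to the
contributions of the pairs, the result is constant on the pairs and supported on `supp B`. -/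
theorem isPairwiseConst_add {g : ℕ → ZMod 2}
    (hodd : ∀ a b, a < b → s(a, b) ∈ odd B → g a = g b)
    (hseq : ∀ k, 1 ≤ k → k ≤ 2 * (even B).card → g (i k) = 0)
    (hmid : ∀ h, h ∉ supp B →
      ¬ (1 ≤ h ∧ h ≤ N) ∨ (even B).card = 0 ∨ i 1 ≤ h ∧ h ≤ i (2 * (even B).card) → g h = 0)
    (hout : ∀ h, h ∉ supp B → 0 < (even B).card → 1 ≤ h → h ≤ N →
      h < i 1 ∨ i (2 * (even B).card) < h → ((even B).card : ZMod 2) + g h = 0) :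
    IsPairwiseConst B (pairSum N B + g) ∧
    ∀ k ∈ range (even B).card, (pairSum N B + g) (i (k + 1)) = ((even B).card - k : ℕ) := by
  refine ⟨⟨fun h hh => ?_, fun X hX => ?_⟩, fun k hk => ?_⟩
  · have hho : h ∉ supp (odd B) := fun h1 => by
      obtain ⟨X, hX, hx⟩ := mem_supp.1 h1
      exact hh (mem_supp.2 ⟨X, odd_subset hX, hx⟩)
    rw [Pi.add_apply]
    by_cases hN : 1 ≤ h ∧ h ≤ N
    · by_cases hs : (even B).card = 0
      · rw [S.pairSum_mid hho (Or.inl hs), hmid h hh (by tauto), add_zero]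
      · by_cases h1 : i 1 ≤ h ∧ h ≤ i (2 * (even B).card)
        · rw [S.pairSum_mid hho (Or.inr (S.mid_of_not_mem_supp (by omega) h1.1 h1.2 hh)),
            hmid h hh (by tauto), add_zero]
        · rw [S.pairSum_outer hho hN.1 hN.2 (by omega)]
          exact hout h hh (by omega) hN.1 hN.2 (by omega)
    · rw [S.pairSum_of_not_mem_Icc hN, hmid h hh (by tauto), add_zero]
  · suffices h : ∃ a b, X = s(a, b) ∧ (pairSum N B + g) a = (pairSum N B + g) b by
      obtain ⟨a, b, rfl, h⟩ := h
      intro x hx y hy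
      rcases Sym2.mem_iff.1 hx with rfl | rfl <;> rcases Sym2.mem_iff.1 hy with rfl | rfl <;>
        simp [h]
    rcases mem_even_or_odd hX with h | h
    · obtain ⟨k, hk, hk', rfl⟩ := S.even_pair_cases h
      have h1 := S.pairSum_seq hk hk'
      exact ⟨_, _, rfl, by
        simp only [Pi.add_apply, h1.1, h1.2, hseq k hk (by omega),
          hseq (2 * (even B).card + 1 - k) (by omega) (by omega)]⟩
    · obtain ⟨a, b, hab, rfl, -, -⟩ := exists_lt_of_mem S.mem_P hX
      exact ⟨a, b, rfl, by simp only [Pi.add_apply, S.pairSum_odd hab h, hodd a b hab h]⟩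
  · have hk := mem_range.1 hk
    rw [Pi.add_apply, (S.pairSum_seq (k := k + 1) (by omega) (by omega)).1,
      hseq (k + 1) (by omega) (by omega), add_zero, Nat.add_sub_add_right]

theorem signedCard_of_eq {g : ℕ → ZMod 2} (hg : IsPairwiseConst B g)
    (h : ∀ k ∈ range (even B).card, g (i (k + 1)) = ((even B).card - k : ℕ)) :
    signedCard N g =
      -2 * (-1) ^ (i 1) * (-1) ^ (even B).card * (((even B).card + 1) / 2 : ℕ) := by
  rw [S.signedCard_eq hg, sum_congr rfl fun k hk => by rw [h k hk], alternating_sum_parity]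
  ring

theorem signedCard_bounds {g : ℕ → ZMod 2} (hg : IsPairwiseConst B g) :
    ∃ c : ℤ, signedCard N g = 2 * (-1) ^ i 1 * c ∧ -((((even B).card / 2 : ℕ)) : ℤ) ≤ c ∧
      c ≤ ((((even B).card + 1) / 2 : ℕ) : ℤ) :=
  ⟨_, S.signedCard_eq hg, alternating_sum_bounds _ (fun _ => by positivity) fun k => by
    have := ZMod.val_lt (g (i (k + 1)))
    omega⟩

end IsStar

/-! ### The correction term `δ_B` -/

theorem isStar_of_mem_starP (hB : B ∈ starP N) : ∃ i, IsStar N B i := by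
  obtain ⟨h1, h2, i, h3, h4⟩ := hB
  exact ⟨i, h1, h2, h3, h4⟩

theorem supp_odd_subset : supp (odd B) ⊆ supp B := biUnion_subset_biUnion_of_subset_left _ odd_subset

theorem supp_even_subset : supp (even B) ⊆ supp B :=
  biUnion_subset_biUnion_of_subset_left _ even_subset

theorem vec_apply (Y : Finset ℕ) (h : ℕ) : vec Y h = if h ∈ Y then 1 else 0 := rfl

namespace IsStar

/-- The part of the conclusion of `isPairwiseConst_add` on which the degree depends. -/
def HasSeqValues (B : Pairs) (i : ℕ → ℕ) (g : ℕ → ZMod 2) : Prop :=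
  IsPairwiseConst B g ∧ ∀ k ∈ range (even B).card, g (i (k + 1)) = ((even B).card - k : ℕ)

variable (S : IsStar N B i)
include S

theorem not_mem_supp_of_split {x y u : ℕ} (hu : 1 ≤ u) (hx : x ≤ u) (hy : u ≤ y)
    (h1 : Covered0 (odd B) (Icc x (u - 1))) (h2 : Covered0 (odd B) (Icc (u + 1) y))
    (hxy : ∀ a b, a < b → s(a, b) ∈ odd B → (a ∈ Icc x y ↔ b ∈ Icc x y)) :
    u ∉ supp (odd B) := by
  intro hus
  obtain ⟨X, hX, huX⟩ := mem_supp.1 hus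
  obtain ⟨a, b, hab, rfl, -, -⟩ := exists_lt_of_mem S.mem_P (odd_subset hX)
  have h3 := h1.mem_iff S.mem_P S.interior hab hX
  have h4 := h2.mem_iff S.mem_P S.interior hab hX
  have h5 := hxy a b hab hX
  simp only [mem_Icc] at h3 h4 h5
  rcases Sym2.mem_iff.1 huX with h | h <;> omega

theorem last_lt (hN : N ∉ supp B) {k : ℕ} (hk : 1 ≤ k) (hk' : k ≤ 2 * (even B).card) :
    i k < N := by
  have h1 := S.seq_mem_Icc hk hk'
  have h2 : i k ≠ N := fun h => hN (h ▸ supp_even_subset (S.seq.mem_supp hk hk'))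
  omega

theorem first_le {k : ℕ} (hk : 1 ≤ k) (hk' : k ≤ 2 * (even B).card) :
    i 1 ≤ i k ∧ i k ≤ i (2 * (even B).card) :=
  ⟨(S.seq.le_iff le_rfl (by omega) hk hk').2 hk, (S.seq.le_iff hk hk' (by omega) le_rfl).2 hk'⟩

theorem mem_supp_of_covered {Z : Finset ℕ} (hZ : Covered0 (odd B) Z) {h : ℕ} (hh : h ∈ Z) :
    h ∈ supp B :=
  supp_odd_subset (hZ.mem_supp S.mem_P S.interior hh)

/-- Outside `[i_1, i_{2s}]` only `u` and `N` can be missing from `supp B`. The pair part is `s = 1`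
mod 2 there, and `{N} + [1, u]` cancels it while vanishing on the `i_k`. The parities come from the
even lengths of `[1, u - 1]` and `[u + 1, i_1 - 1]`. -/
theorem left_case (hN : N ∉ supp B) (hs : Odd (even B).card) {u : ℕ} (hu : u ∈ Icc 1 (i 1 - 1))
    (h1 : Covered0 (odd B) (Icc 1 (u - 1))) (h2 : Covered0 (odd B) (Icc (u + 1) (i 1 - 1)))
    (h3 : Covered0 (odd B) (Icc (i (2 * (even B).card) + 1) (N - 1))) :
    Odd u ∧ Even (i 1) ∧
      HasSeqValues B i (pairSum N B + (vec (Icc N N) + vec (Icc 1 u))) := by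
  have hs0 := hs.pos
  have hu := mem_Icc.1 hu
  have hi1 := S.last_lt hN (k := 1) le_rfl (by omega)
  have hil := S.last_lt hN (k := 2 * (even B).card) (by omega) le_rfl
  have hii := S.first_le (k := 1) le_rfl (by omega)
  have hus : u ∉ supp (odd B) := by
    refine S.not_mem_supp_of_split hu.1 hu.1 hu.2 h1 h2 fun a b hab hp => ?_
    have ha := S.mem_Icc_of_mem_supp (mem_supp.2 ⟨_, odd_subset hp, Sym2.mem_mk_left a b⟩)
    have := S.le_iff_of_odd hab hp (S.seq_not_mem_supp (k := 1) le_rfl (by omega))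
    simp only [mem_Icc]
    omega
  have e1 := h1.even_card S.mem_P
  have e2 := h2.even_card S.mem_P
  rw [Nat.card_Icc] at e1 e2
  refine ⟨by grind, by grind, S.isPairwiseConst_add ?_ ?_ ?_ ?_⟩
  · intro a b hab hp
    have ha := mem_supp.2 ⟨_, odd_subset hp, Sym2.mem_mk_left a b⟩
    have hb := mem_supp.2 ⟨_, odd_subset hp, Sym2.mem_mk_right a b⟩
    have haN : a ≠ N := fun h => hN (h ▸ ha)
    have hbN : b ≠ N := fun h => hN (h ▸ hb)
    have ha := S.mem_Icc_of_mem_supp ha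
    have hb := S.mem_Icc_of_mem_supp hb
    have := S.le_iff_of_odd hab hp hus
    have haN' : ¬ (N ≤ a ∧ a ≤ N) := by omega
    have hbN' : ¬ (N ≤ b ∧ b ≤ N) := by omega
    simp only [Pi.add_apply, vec_apply, mem_Icc, ha.1, hb.1, this.1, true_and, haN', hbN', if_false]
  · intro k hk hk'
    have := S.first_le hk hk'
    have := S.last_lt hN hk hk'
    simp only [Pi.add_apply, vec_apply, mem_Icc]
    rw [if_neg (by omega), if_neg (by omega), add_zero]
  · intro h hh hc
    simp only [Pi.add_apply, vec_apply, mem_Icc]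
    rw [if_neg (by omega), if_neg (by omega), add_zero]
  · intro h hh _ hh1 hhN hc
    have hs1 : (((even B).card : ℕ) : ZMod 2) = 1 := ZMod.natCast_eq_one_iff_odd.2 hs
    have n1 : ¬ (1 ≤ h ∧ h ≤ u - 1) := fun hc =>
      hh (S.mem_supp_of_covered h1 (mem_Icc.2 hc))
    have n2 : ¬ (u + 1 ≤ h ∧ h ≤ i 1 - 1) := fun hc =>
      hh (S.mem_supp_of_covered h2 (mem_Icc.2 hc))
    have n3 : ¬ (i (2 * (even B).card) + 1 ≤ h ∧ h ≤ N - 1) := fun hc =>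
      hh (S.mem_supp_of_covered h3 (mem_Icc.2 hc))
    simp only [Pi.add_apply, vec_apply, mem_Icc, hs1]
    -- Here `h = u` on the left and `h = N` on the right.
    rcases hc with hc | hc
    · rw [if_neg (by omega), if_pos (by omega)]; rfl
    · rw [if_pos (by omega), if_neg (by omega)]; rfl

/-- As on the left, with `[u, N]` meeting the uncovered points in `u` and `N`. The parity of `u` is
found by passing from `i_1` to `i_{2s}`, which have the same parity. -/
theorem right_case (hN : N ∉ supp B) (hs : Odd (even B).card) {u : ℕ}
    (hu : u ∈ Icc (i (2 * (even B).card) + 1) (N - 1))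
    (h1 : Covered0 (odd B) (Icc (i (2 * (even B).card) + 1) (u - 1)))
    (h2 : Covered0 (odd B) (Icc (u + 1) (N - 1)))
    (h3 : Covered0 (odd B) (Icc 1 (i 1 - 1))) :
    Even u ∧ Odd (i 1) ∧ HasSeqValues B i (pairSum N B + vec (Icc u N)) := by
  have hs0 := hs.pos
  have hu := mem_Icc.1 hu
  have hi1 := S.seq_mem_Icc (k := 1) le_rfl (by omega)
  have hil := S.last_lt hN (k := 2 * (even B).card) (by omega) le_rfl
  have hii := S.first_le (k := 1) le_rfl (by omega)
  have hus : u ∉ supp (odd B) := by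
    refine S.not_mem_supp_of_split (by omega) hu.1 hu.2 h1 h2 fun a b hab hp => ?_
    have ha := mem_supp.2 ⟨_, odd_subset hp, Sym2.mem_mk_left a b⟩
    have hb := mem_supp.2 ⟨_, odd_subset hp, Sym2.mem_mk_right a b⟩
    have haN : a ≠ N := fun h => hN (h ▸ ha)
    have hbN : b ≠ N := fun h => hN (h ▸ hb)
    have ha := S.mem_Icc_of_mem_supp ha
    have hb := S.mem_Icc_of_mem_supp hb
    have := S.le_iff_of_odd hab hp
      (S.seq_not_mem_supp (k := 2 * (even B).card) (by omega) le_rfl)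
    simp only [mem_Icc]
    omega
  have e1 := h1.even_card S.mem_P
  have e3 := h3.even_card S.mem_P
  rw [Nat.card_Icc] at e1 e3
  have e4 := S.even_sub (k := 1) le_rfl (by omega)
  rw [Nat.add_sub_cancel] at e4
  refine ⟨by grind, by grind, S.isPairwiseConst_add ?_ ?_ ?_ ?_⟩
  · intro a b hab hp
    have ha := S.mem_Icc_of_mem_supp (mem_supp.2 ⟨_, odd_subset hp, Sym2.mem_mk_left a b⟩)
    have hb := S.mem_Icc_of_mem_supp (mem_supp.2 ⟨_, odd_subset hp, Sym2.mem_mk_right a b⟩)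
    have := S.le_iff_of_odd hab hp hus
    simp only [vec_apply, mem_Icc, ha.2, hb.2, this.2]
  · intro k hk hk'
    have := S.first_le hk hk'
    simp only [vec_apply, mem_Icc]
    rw [if_neg (by omega)]
  · intro h hh hc
    simp only [vec_apply, mem_Icc]
    rw [if_neg (by omega)]
  · intro h hh _ hh1 hhN hc
    have hs1 : (((even B).card : ℕ) : ZMod 2) = 1 := ZMod.natCast_eq_one_iff_odd.2 hs
    have n1 : ¬ (i (2 * (even B).card) + 1 ≤ h ∧ h ≤ u - 1) := fun hc =>
      hh (S.mem_supp_of_covered h1 (mem_Icc.2 hc))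
    have n3 : ¬ (1 ≤ h ∧ h ≤ i 1 - 1) := fun hc =>
      hh (S.mem_supp_of_covered h3 (mem_Icc.2 hc))
    simp only [vec_apply, mem_Icc, hs1]
    rw [if_pos (by omega)]; rfl

/-- No correction is needed: either there are no even pairs, or every point outside `[i_1, i_{2s}]`
is covered. -/
theorem zero_case (h : (even B).card = 0 ∨ Covered0 (odd B) (Icc 1 (i 1 - 1)) ∧
    Covered0 (odd B) (Icc (i (2 * (even B).card) + 1) N)) :
    HasSeqValues B i (pairSum N B) := by
  have := S.isPairwiseConst_add (g := 0) (by simp) (by simp) (by simp) ?_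
  · rwa [add_zero] at this
  · intro x hx hs hx1 hxN hc
    obtain ⟨h1, h2⟩ := h.resolve_left hs.ne'
    rcases hc with hc | hc
    · exact (hx (S.mem_supp_of_covered h1 (mem_Icc.2 (by omega)))).elim
    · exact (hx (S.mem_supp_of_covered h2 (mem_Icc.2 (by omega)))).elim

end IsStar

open IsStar

theorem not_mem_XPlus_of_mem_XMinus (hB : B ∈ XMinus N) : B ∉ XPlus N := by
  intro h
  have : ∃ j, s(j, N) ∈ B := by
    rcases Nat.even_or_odd (even B).card with he | ho
    · obtain ⟨j, -, hj⟩ := hB.2.2.1 he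
      exact ⟨j, hj⟩
    · obtain ⟨j, -, hj⟩ := hB.2.2.2 ho
      exact ⟨j, hj⟩
  obtain ⟨j, hj⟩ := this
  exact h.2.1 (mem_supp.2 ⟨_, hj, Sym2.mem_mk_right _ _⟩)

theorem eps'_of_not (h : ¬ (B ∈ XPlus N ∧ Odd (even B).card)) : eps' N B = pairSum N B := by
  rw [eps', if_neg h, add_zero, pairSum]

theorem exists_isU (hB : B ∈ XPlus N) (ho : Odd (even B).card) : ∃ u, IsU N B u := by
  obtain ⟨-, i, hi, h⟩ := hB.2.2.resolve_left ho.pos.ne'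
  rcases h with h | h
  · obtain ⟨u, h1, h2, h3⟩ := h.1.exists_split le_rfl
    exact ⟨u, i, hi, Or.inl ⟨h, h1, h2, h3⟩⟩
  · obtain ⟨u, h1, h2, h3⟩ := h.2.exists_split (by omega)
    exact ⟨u, i, hi, Or.inr ⟨h, h1, h2, h3⟩⟩

theorem XPlus_structure (hB : B ∈ XPlus N) : ∃ i, IsStar N B i ∧ HasSeqValues B i (eps' N B) ∧
    ((even B).card = 0 ∨ Odd (even B).card ∧ (Even (uB N B) ↔ Odd (i 1))) := by
  obtain ⟨i, S⟩ := isStar_of_mem_starP hB.1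
  refine ⟨i, S, ?_⟩
  rcases hB.2.2 with h | ⟨ho, -⟩
  · refine ⟨?_, Or.inl h⟩
    rw [eps'_of_not (by simp [h])]
    exact S.zero_case (Or.inl h)
  · have hu : IsU N B (uB N B) := Nat.sInf_mem (exists_isU hB ho)
    obtain ⟨j, hj, h⟩ := hu
    -- The sequence `j` behind `u_B` need not be `i`, but the cases involve only its ends.
    have hends := S.seq.ends_eq hj ho.pos
    simp only [CaseLeft, CaseRight, ← hends.1, ← hends.2] at h
    rw [eps', if_pos ⟨hB, ho⟩]
    rcases h with ⟨h0, h1, h2, h3⟩ | ⟨h0, h1, h2, h3⟩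
    · obtain ⟨h4, h5, h6⟩ := S.left_case hB.2.1 ho h1 h2 h3 h0.2
      rw [if_neg (Nat.not_even_iff_odd.2 h4)]
      refine ⟨h6, Or.inr ⟨ho, ?_⟩⟩
      rw [← Nat.not_odd_iff_even, ← Nat.not_even_iff_odd (n := i 1)]
      tauto
    · obtain ⟨h4, h5, h6⟩ := S.right_case hB.2.1 ho h1 h2 h3 h0.1
      rw [if_pos h4]
      exact ⟨h6, Or.inr ⟨ho, by tauto⟩⟩

theorem XMinus_structure (hB : B ∈ XMinus N) : ∃ i, IsStar N B i ∧ HasSeqValues B i (eps' N B) ∧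
    ((even B).card = 0 ∨ Odd (i 1)) := by
  obtain ⟨i, S⟩ := isStar_of_mem_starP hB.1
  refine ⟨i, S, ?_⟩
  rw [eps'_of_not fun h => not_mem_XPlus_of_mem_XMinus hB h.1]
  rcases hB.2.1 with h | ⟨j, hj, h1, h2⟩
  · exact ⟨S.zero_case (Or.inl h), Or.inl h⟩
  · by_cases hs : (even B).card = 0
    · exact ⟨S.zero_case (Or.inl hs), Or.inl hs⟩
    have hends := S.seq.ends_eq hj (by omega)
    rw [← hends.1] at h1
    rw [← hends.2] at h2
    refine ⟨S.zero_case (Or.inr ⟨h1, h2⟩), Or.inr ?_⟩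
    have e1 := h1.even_card S.mem_P
    have := S.seq_mem_Icc (k := 1) le_rfl (by omega)
    rw [Nat.card_Icc] at e1
    grind

/-! ### Degrees and triangularity -/

/-- The properties of the degree `t` of `B` that make the relation `⪯` triangular. -/
structure HasDegree (N : ℕ) (B : Pairs) (t : ℤ) : Prop where
  signedCard_eps' : signedCard N (eps' N B) = t
  abs_le : ∀ g ∈ span B, |signedCard N g| ≤ |t|
  ne_neg : ∀ g ∈ span B, t < 0 → signedCard N g ≠ -t
  card_eq_zero : t = 0 → (even B).card = 0

/-- The value `t` is the extreme of the range `2 (-1)^{i_1} c` of larger absolute value, or either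
extreme when `s` is even. Of the listed cases only `s` and `i_1` both odd gives `t < 0`; then `c ≥
-(s - 1) / 2` rules out `-t`. -/
theorem IsStar.hasDegree (S : IsStar N B i) (h : HasSeqValues B i (eps' N B)) {t : ℤ}
    (ht : (even B).card = 0 ∧ t = 0 ∨
      0 < (even B).card ∧ Odd (even B).card ∧ Odd (i 1) ∧ t = -(((even B).card : ℤ) + 1) ∨
      0 < (even B).card ∧ Odd (even B).card ∧ Even (i 1) ∧ t = ((even B).card : ℤ) + 1 ∨
      0 < (even B).card ∧ Even (even B).card ∧ Odd (i 1) ∧ t = ((even B).card : ℤ)) :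
    HasDegree N B t := by
  have h1 := S.signedCard_of_eq h.1 h.2
  have h2 : ∀ g ∈ span B, ∃ c : ℤ, signedCard N g = 2 * (-1) ^ i 1 * c ∧
      -((((even B).card / 2 : ℕ)) : ℤ) ≤ c ∧ c ≤ ((((even B).card + 1) / 2 : ℕ) : ℤ) :=
    fun g hg => S.signedCard_bounds (isPairwiseConst_of_mem_span S.mem_P hg)
  rcases ht with ⟨hs, rfl⟩ | ⟨hs, h3, h4, rfl⟩ | ⟨hs, h3, h4, rfl⟩ | ⟨hs, h3, h4, rfl⟩
  · simp only [hs] at h1 h2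
    refine ⟨by simpa using h1, fun g hg => ?_, by simp, fun _ => hs⟩
    obtain ⟨c, hc, hc1, hc2⟩ := h2 g hg
    obtain rfl : c = 0 := by omega
    simp [hc]
  all_goals
    rw [h4.neg_one_pow, h3.neg_one_pow] at h1
    simp only [h4.neg_one_pow] at h2
    obtain ⟨m, hm⟩ := h3
    refine ⟨by omega, fun g hg => ?_, fun g hg hneg => ?_, by omega⟩
    · obtain ⟨c, hc, hc1, hc2⟩ := h2 g hg
      rw [hc]
      rw [abs_le, abs_eq_max_neg]
      omega
    · obtain ⟨c, hc, hc1, hc2⟩ := h2 g hg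
      omega

theorem XPlusT_hasDegree {t : ℤ} (ht : Even t) (hB : B ∈ XPlusT N t) : HasDegree N B t := by
  obtain ⟨i, S, h, h1⟩ := XPlus_structure hB.1
  refine S.hasDegree h ?_
  obtain ⟨r, rfl⟩ := ht
  rcases h1 with h1 | ⟨ho, h1⟩
  · rcases hB.2 with h2 | h2 | h2
    all_goals exact Or.inl ⟨h1, by omega⟩
  · have hp := ho.pos
    rcases hB.2 with h2 | h2 | h2
    · omega
    · refine Or.inr (Or.inr (Or.inl ⟨hp, ho, ?_, by omega⟩))
      rw [← Nat.not_odd_iff_even, ← h1, Nat.not_even_iff_odd]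
      exact h2.2.2
    · exact Or.inr (Or.inl ⟨hp, ho, h1.1 h2.2.2, by omega⟩)

theorem XMinusT_hasDegree {t : ℤ} (ht : Even t) (hB : B ∈ XMinusT N t) : HasDegree N B t := by
  obtain ⟨i, S, h, h1⟩ := XMinus_structure hB.1
  refine S.hasDegree h ?_
  obtain ⟨r, rfl⟩ := ht
  by_cases hs : (even B).card = 0
  · rcases hB.2 with h2 | h2 | h2
    all_goals exact Or.inl ⟨hs, by omega⟩
  · have h1 := h1.resolve_left hs
    rcases hB.2 with h2 | h2 | h2
    · omega
    · exact Or.inr (Or.inr (Or.inr ⟨by omega, by grind, h1, by omega⟩))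
    · exact Or.inr (Or.inl ⟨by omega, by grind, h1, by omega⟩)

theorem exists_hasDegree (hB : B ∈ X N) : ∃ t, Even t ∧ HasDegree N B t := by
  rcases hB with hB | hB
  · obtain ⟨i, S, h, h1⟩ := XPlus_structure hB
    rcases h1 with h1 | ⟨ho, -⟩
    · exact ⟨0, by simp, S.hasDegree h (Or.inl ⟨h1, rfl⟩)⟩
    · rcases Nat.even_or_odd (i 1) with h2 | h2
      · exact ⟨_, by grind, S.hasDegree h (Or.inr (Or.inr (Or.inl ⟨ho.pos, ho, h2, rfl⟩)))⟩
      · exact ⟨_, by grind, S.hasDegree h (Or.inr (Or.inl ⟨ho.pos, ho, h2, rfl⟩))⟩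
  · obtain ⟨i, S, h, h1⟩ := XMinus_structure hB
    by_cases hs : (even B).card = 0
    · exact ⟨0, by simp, S.hasDegree h (Or.inl ⟨hs, rfl⟩)⟩
    · have h1 := h1.resolve_left hs
      rcases Nat.even_or_odd (even B).card with h2 | h2
      · exact ⟨_, by grind,
          S.hasDegree h (Or.inr (Or.inr (Or.inr ⟨by omega, h2, h1, rfl⟩)))⟩
      · exact ⟨_, by grind, S.hasDegree h (Or.inr (Or.inl ⟨by omega, h2, h1, rfl⟩))⟩

/-- Intermediate members may come from either half of `X N`, so the induction uses that each of them
has some degree. -/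
theorem HasDegree.of_prec {A : Pairs} {t t' : ℤ} (hB : HasDegree N B t) (hA : HasDegree N A t')
    (h : Prec N A B) : |t'| ≤ |t| ∧ (t < 0 → t' ≠ -t) := by
  induction h using Relation.ReflTransGen.head_induction_on generalizing t' with
  | refl =>
    obtain rfl : t = t' := hB.1.symm.trans hA.1
    exact ⟨le_rfl, fun h => by omega⟩
  | head hstep _ ih =>
    obtain ⟨-, hC, hmem⟩ := hstep
    obtain ⟨r, -, hr⟩ := exists_hasDegree hC
    have h1 := ih hr
    have h2 := hr.abs_le _ hmem
    have h3 := hr.ne_neg _ hmem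
    rw [hA.1] at h2 h3
    -- If `t' = -t`, then `|t| ≤ |r| ≤ |t|`, so `r = ±t`. The value `-t` is excluded by induction,
    -- and `r = t < 0` by `ne_neg` for the first step.
    refine ⟨h2.trans h1.1, fun ht he => ?_⟩
    have h4 := h1.2 ht
    have h5 := h1.1
    subst he
    rw [abs_eq_max_neg, abs_eq_max_neg] at h2 h5
    omega

/-! ### Stability of `'𝒳^{0,+}` -/

/-- All pairs are odd, and an interval other than that of `b` ends strictly before the maximum `b`.
-/
theorem pairSum_eq_one (hB : B ∈ P N) (hs : even B = ∅) {b : ℕ} (hb : b ∈ supp B)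
    (hgt : ∀ h ∈ supp B, h ≤ b) : pairSum N B b = 1 := by
  obtain ⟨X, hX, hbX⟩ := mem_supp.1 hb
  have hodd : ∀ Y ∈ B, Y ∈ odd B := fun Y hY =>
    (mem_even_or_odd hY).resolve_left (by simp [hs])
  rw [pairSum, Finset.sum_apply, sum_eq_single X]
  · obtain ⟨c, d, hcd, rfl, -, -⟩ := exists_lt_of_mem hB hX
    have hd := hgt d (mem_supp.2 ⟨_, hX, Sym2.mem_mk_right _ _⟩)
    have := (mem_dbl_odd (N := N) (h := b) hcd ((mem_odd hcd).1 (hodd _ hX)).2).2 (by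
      rcases Sym2.mem_iff.1 hbX with h | h <;> omega)
    simp [vec, this]
  · intro Y hY hne
    obtain ⟨c, d, hcd, rfl, -, -⟩ := exists_lt_of_mem hB hY
    have hd := hgt d (mem_supp.2 ⟨_, hY, Sym2.mem_mk_right _ _⟩)
    have hbd : b ≠ d := by
      rintro rfl
      exact hne (eq_of_mem hB hY hX (Sym2.mem_mk_right _ _) hbX)
    have : b ∉ dbl N s(c, d) := by
      rw [mem_dbl_odd hcd ((mem_odd hcd).1 (hodd _ hY)).2]
      omega
    simp [vec, this]
  · exact fun h => (h hX).elim

theorem mem_XPrimePlusZero_of_step {A : Pairs} (hB : B ∈ XPrimePlusZero N) (hA : A ∈ X N)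
    (h : eps' N A ∈ span B) : A ∈ XPrimePlusZero N := by
  obtain ⟨i, S⟩ := isStar_of_mem_starP hB.1.1.1
  have hdB := XPlusT_hasDegree (by simp) hB.1
  have hc := isPairwiseConst_of_mem_span S.mem_P h
  obtain ⟨t, -, hdA⟩ := exists_hasDegree hA
  have ht := hdB.abs_le _ h
  rw [hdA.1, abs_zero, abs_nonpos_iff] at ht
  have hs := hdA.card_eq_zero ht
  have hAP : A ∈ P N := by rcases hA with hA | hA <;> exact hA.1.1
  have hle : ∀ x ∈ supp A, x ≤ N := fun x hx => by
    obtain ⟨Y, hY, hxY⟩ := mem_supp.1 hx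
    exact (mem_Icc.1 ((hAP.1 Y hY).2 (Sym2.mem_toFinset.2 hxY))).2
  have he : even A = ∅ := card_eq_zero.1 hs
  rw [eps'_of_not (by simp [hs])] at hc
  -- If `N` were in `supp A` it would be the maximum, so `'ε(A)` would be `1` at a point outside
  -- `supp B`. The same then applies to `N - 1`.
  have hN : N ∉ supp A := fun hN => by
    have := hc.1 N hB.1.1.2.1
    rw [pairSum_eq_one hAP he hN hle] at this
    exact one_ne_zero this
  have hN1 : N - 1 ∉ supp A := fun hN1 => by
    have := hc.1 (N - 1) hB.2
    rw [pairSum_eq_one hAP he hN1 fun x hx => by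
      have := hle x hx
      have : x ≠ N := fun h => hN (h ▸ hx)
      omega] at this
    exact one_ne_zero this
  refine ⟨⟨?_, Or.inl ⟨rfl, hs⟩⟩, hN1⟩
  rcases hA with hA | hA
  · exact hA
  · exact ⟨hA.1, hN, Or.inl hs⟩

end PairSets

theorem mainTheorem7 (N : ℕ) (hN3 : 3 ≤ N) (hN : Odd N) :
    (∀ t t' : ℤ, Even t → Even t' →
      ∀ B' ∈ PairSets.XPlusT N t', ∀ B ∈ PairSets.XPlusT N t,
        PairSets.Prec N B' B → t < 0 → t' = t ∨ |t'| < |t|) ∧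
    (∀ B' ∈ PairSets.X N, ∀ B ∈ PairSets.XPrimePlusZero N,
        PairSets.Prec N B' B → B' ∈ PairSets.XPrimePlusZero N) ∧
    (∀ t t' : ℤ, Even t → Even t' →
      ∀ B' ∈ PairSets.XMinusT N t', ∀ B ∈ PairSets.XMinusT N t,
        PairSets.Prec N B' B → 0 ≤ t → t' = t ∨ |t' + 1| < |t + 1|) := by
  refine ⟨fun t t' ht ht' B' hB' B hB h hneg => ?_, fun B' _ B hB h => ?_,
    fun t t' ht ht' B' hB' B hB h hpos => ?_⟩
  · have := (PairSets.XPlusT_hasDegree ht hB).of_prec (PairSets.XPlusT_hasDegree ht' hB') h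
    simp only [abs_eq_max_neg] at this ⊢
    omega
  · induction h using Relation.ReflTransGen.head_induction_on with
    | refl => exact hB
    | head hstep _ ih => exact PairSets.mem_XPrimePlusZero_of_step (ih hstep.2.1) hstep.1 hstep.2.2
  · have := (PairSets.XMinusT_hasDegree ht hB).of_prec (PairSets.XMinusT_hasDegree ht' hB') h
    -- For `t ≥ 0`, `|t'| ≤ t` places `t' + 1` in `[1 - t, t + 1]`, where only the right end has
    -- absolute value as large as `t + 1`.
    simp only [abs_eq_max_neg] at this ⊢
    omega
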